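/- There is a universal constant $C>0$ such that the following holds. Let $V$ be a finite set with at least two elements, let $P:V\times V\to[0,\infty)$ have symmetric support, write $x\sim y$ if $P(x,y)>0$, and let $d$ be a (finite) metric on $V$ which is a path distance, i.e. $$d(x,y)=\inf\Big\{\sum_{k=1}^n d(x_{k-1},x_k) : x=x_0\sim x_1\sim\dots\sim x_n=y\Big\}\quad\text{for all }x,y\in V$$ (in particular, the graph is connected; row sums of $P$ need not be $1$). Let $m$ be the invariant probability measure of the chain and assume that the chain is reversible, $m(x)P(x,y)=m(y)P(y,x)$ for all $x,y$. Put $\Delta f(x)=\sum_y P(x,y)(f(y)-f(x))$, $\langle f,g\rangle=\sum_x f(x)g(x)m(x)$, $\|f\|_2=\langle f,f\rangle^{1/2}$ and $\mathcal E(f,f)=-\langle\Delta f,f\rangle$. Assume that the Ollivier curvature is non-negative, i.e. for all $x\ne y$ with $x\sim y$, $$\kappa(x,y)=\inf\Big\{\frac{\Delta f(x)-\Delta f(y)}{d(x,y)} : f\in\mathbb R^V\text{ is 1-Lipschitz with respect to } d,\ f(y)-f(x)=d(x,y)\Big\}\ge 0 .$$ Then the log-Sobolev constant $$\alpha=\inf\Big\{\frac{\mathcal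 E(f,f)}{\operatorname{Ent}(f^2)} : f\in\mathbb R^V,\ \|f\|_2=1,\ \operatorname{Ent}(f^2)\neq 0\Big\},\qquad \operatorname{Ent}(g)=\langle g,\log g\rangle\quad (0\log 0=0),$$ satisfies $$\alpha\ \ge\ \frac{C\,P_0}{\operatorname{diam}^2},\qquad P_0=\min_{x\sim y,\ x\neq y}P(x,y)\,d(x,y)^2,\qquad \operatorname{diam}=\max_{x,y\in V}d(x,y).$$ -/

import Mathlib

noncomputable section

/-- A connected metric (continuous time) Markov chain on a finite set `V`: a non-negative kernel
`P` with symmetric support and a metric `d` on `V` which is the path distance of the graph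
`x ∼ y ↔ 0 < P x y`. No normalisation of the row sums of `P` is required, and `P x x` may be
positive. As `d` is real valued, `d_path` forces any two points to be joined by a path
(the empty set has no greatest lower bound in `ℝ`), see `MetricMarkovChain.connected`. -/
structure MetricMarkovChain (V : Type*) [Fintype V] where
  P : V → V → ℝ
  P_nonneg : ∀ x y, 0 ≤ P x y
  P_support_symm : ∀ x y, 0 < P x y → 0 < P y x
  d : V → V → ℝ
  d_nonneg : ∀ x y, 0 ≤ d x y
  d_symm : ∀ x y, d x y = d y x
  d_eq_zero : ∀ x y, d x y = 0 ↔ x = y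
  /-- `d x y` is the infimum of the lengths of the paths `x = z 0 ∼ z 1 ∼ … ∼ z n = y`. -/
  d_path : ∀ x y, IsGLB {l : ℝ | ∃ (n : ℕ) (z : ℕ → V), z 0 = x ∧ z n = y ∧
    (∀ k < n, 0 < P (z k) (z (k + 1))) ∧ l = ∑ k ∈ Finset.range n, d (z k) (z (k + 1))} (d x y)

namespace MetricMarkovChain

/-- `⟨f, g⟩ = ∑ x, f x * g x * m x`. -/
def inner {V : Type*} [Fintype V] (m f g : V → ℝ) : ℝ := ∑ x, f x * g x * m x

/-- The `ℓ²(V, m)` norm. -/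
def norm2 {V : Type*} [Fintype V] (m f : V → ℝ) : ℝ := √(inner m f f)

/-- `Ent f = ⟨f, log f⟩` for densities `f ≥ 0` with `‖f‖₁ = 1`;
the convention `0 * log 0 = 0` is built into `Real.log 0 = 0`. -/
def entropy {V : Type*} [Fintype V] (m f : V → ℝ) : ℝ := inner m f (fun x => Real.log (f x))

variable {V : Type*} [Fintype V] (G : MetricMarkovChain V)

theorem connected (x y : V) : ∃ (n : ℕ) (z : ℕ → V), z 0 = x ∧ z n = y ∧
    ∀ k < n, 0 < G.P (z k) (z (k + 1)) := by
  by_contra h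
  have h2 := (G.d_path x y).2 (show G.d x y + 1 ∈ lowerBounds _ from ?_)
  · linarith
  · rintro l ⟨n, z, h0, hn, hz, -⟩
    exact absurd ⟨n, z, h0, hn, hz⟩ h

/-- `m` is an invariant probability measure (unique, as the chain is connected). -/
def IsInvariantMeasure (m : V → ℝ) : Prop :=
  (∀ x, 0 ≤ m x) ∧ ∑ x, m x = 1 ∧ ∀ x, ∑ y, m x * G.P x y = ∑ y, m y * G.P y x

/-- Reversibility of the chain with respect to `m` (detailed balance). -/
def IsReversible (m : V → ℝ) : Prop := ∀ x y, m x * G.P x y = m y * G.P y x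

/-- The set of 1-Lipschitz functions. -/
def lip1 : Set (V → ℝ) := {f | ∀ x y, |f y - f x| ≤ G.d x y}

/-- The Laplacian `Δ f x = ∑ y, P x y * (f y - f x)`. -/
def laplacian (f : V → ℝ) (x : V) : ℝ := ∑ y, G.P x y * (f y - f x)

/-- The Dirichlet form `ℰ(f, g) = - ⟨Δ f, g⟩`. -/
def dirichletForm (m f g : V → ℝ) : ℝ := - inner m (G.laplacian f) g

/-- The Ollivier curvature of an edge `x ∼ y`, `x ≠ y`. -/
def curvature (x y : V) : ℝ :=
  sInf {r : ℝ | ∃ f ∈ G.lip1, f y - f x = G.d x y ∧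
    r = (G.laplacian f x - G.laplacian f y) / G.d x y}

/-- Every edge has non-negative Ollivier curvature. -/
def HasNonnegCurvature : Prop := ∀ x y, x ≠ y → 0 < G.P x y → 0 ≤ G.curvature x y

/-- The minimal transition rate: the infimum of `P x y * d x y ^ 2` over edges `x ∼ y`,
`x ≠ y`. -/
def minRate : ℝ := sInf {r : ℝ | ∃ x y, x ≠ y ∧ 0 < G.P x y ∧ r = G.P x y * G.d x y ^ 2}

/-- The diameter of the chain with respect to `d`. -/
def diam : ℝ := ⨆ p : V × V, G.d p.1 p.2

/-- The (unmodified) log-Sobolev constant: the infimum of `ℰ(f, f) / Ent(f²)` over all `f` with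
`‖f‖₂ = 1` for which the quotient is defined. -/
def logSobolev (m : V → ℝ) : ℝ :=
  sInf {r : ℝ | ∃ f : V → ℝ, norm2 m f = 1 ∧ entropy m (fun x => f x ^ 2) ≠ 0 ∧
    r = G.dirichletForm m f f / entropy m (fun x => f x ^ 2)}

end MetricMarkovChain

end

noncomputable section

open Filter Topology

namespace MetricMarkovChain

/-! ### Path metric, geodesics and curvature -/

section

variable {V : Type*} [Fintype V] (G : MetricMarkovChain V)

/-! Curvature enters only through `laplacian_le`: the Laplacian of a 1-Lipschitz function does not
increase along a tight pair, one on which the function rises by the full distance. Given a set `A`,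
take the least non-positive 1-Lipschitz `f` with Δf ≤ εf on `A`. Minimality joins every point by a
tight pair to a point of `A` where equality holds, so curvature yields Δf ≥ εf everywhere, and every
point off `A` has an edge of full slope (`exists_separating`).

Since `f` oscillates by at most the diameter, Δf ≤ -c on `A` and Δf ≥ -c - c₀ everywhere, with c₀
small. If c is large, a shift of `f` is a positive supersolution on `A`; if c is small, 2 - exp(s(f
- max f)) is one off `A`, thanks to the second-order gain on the full-slope edge. By Barta's
inequality, for each L either `A` has Dirichlet eigenvalue at least of order L·P₀/diam², or its
complement has one of order L²·exp(-L/2)·P₀/diam² (`dirichlet_dichotomy`).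

With L = 1 at a balanced level this is a Poincaré inequality, which controls the entropy where `f`
is bounded. For large values take L = j + 2 at the dyadic level 2^(j+2): either alternative bounds
that level's share of the entropy by the energy of two dyadic slices of `f`
(`level_le_dirichletForm_slice`), and the slice energies sum to at most that of `f`. -/

theorem d_self (x : V) : G.d x x = 0 := (G.d_eq_zero x x).2 rfl

theorem d_pos {x y : V} (h : x ≠ y) : 0 < G.d x y :=
  lt_of_le_of_ne (G.d_nonneg x y) fun h0 => h ((G.d_eq_zero x y).1 h0.symm)

theorem d_le_path_length {x y : V} {n : ℕ} {z : ℕ → V} (h0 : z 0 = x) (hn : z n = y)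
    (hz : ∀ k < n, 0 < G.P (z k) (z (k + 1))) :
    G.d x y ≤ ∑ k ∈ Finset.range n, G.d (z k) (z (k + 1)) :=
  (G.d_path x y).1 ⟨n, z, h0, hn, hz, rfl⟩

theorem d_triangle_of_edge {x y : V} (hxy : 0 < G.P x y) (w : V) :
    G.d x w ≤ G.d x y + G.d y w := by
  have h : G.d x w - G.d x y ≤ G.d y w := by
    refine (G.d_path y w).2 ?_
    rintro l ⟨n, z, h0, hn, hz, rfl⟩
    have := G.d_le_path_length (x := x) (y := w) (n := n + 1)
      (z := fun k => Nat.casesOn k x z) rfl hn (by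
        rintro (_ | k) hk
        · simpa [h0] using hxy
        · exact hz k (by omega))
    rw [Finset.sum_range_succ'] at this
    change G.d x w ≤ _ + G.d x (z 0) at this
    rw [h0] at this
    linarith!
  linarith

theorem d_triangle (x y w : V) : G.d x w ≤ G.d x y + G.d y w := by
  have key : ∀ (n : ℕ) (z : ℕ → V), (∀ k < n, 0 < G.P (z k) (z (k + 1))) →
      G.d (z 0) w ≤ ∑ k ∈ Finset.range n, G.d (z k) (z (k + 1)) + G.d (z n) w := by
    intro n
    induction n with
    | zero => intro z _; simp
    | succ n ih =>
      intro z hz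
      have h1 := ih z fun k hk => hz k (by omega)
      have h2 := G.d_triangle_of_edge (hz n (by omega)) w
      rw [Finset.sum_range_succ]
      linarith
  have h : G.d x w - G.d y w ≤ G.d x y := by
    refine (G.d_path x y).2 ?_
    rintro l ⟨n, z, h0, hn, hz, rfl⟩
    have := key n z hz
    rw [h0, hn] at this
    linarith
  linarith

/-- Loops are allowed, as P x x may be positive, so a path may linger at its start; the induction
discards these idle steps. -/
theorem exists_step_le_path_length {y : V} (n : ℕ) : ∀ (z : ℕ → V), z 0 ≠ y → z n = y →
    (∀ k < n, 0 < G.P (z k) (z (k + 1))) → ∃ w, w ≠ z 0 ∧ 0 < G.P (z 0) w ∧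
      G.d (z 0) w + G.d w y ≤ ∑ k ∈ Finset.range n, G.d (z k) (z (k + 1)) := by
  induction n with
  | zero => intro z h0 hn; exact absurd hn h0
  | succ n ih =>
    intro z h0 hn hz
    have htail : ∀ k < n, 0 < G.P (z (k + 1)) (z (k + 1 + 1)) := fun k hk => hz (k + 1) (by omega)
    rw [Finset.sum_range_succ']
    by_cases h1 : z 1 = z 0
    · obtain ⟨w, hw, hP, hl⟩ := ih (fun k => z (k + 1)) (by simpa [h1] using h0) hn htail
      simp only [zero_add, h1] at hw hP hl
      exact ⟨w, hw, hP, by simpa [h1, d_self] using hl⟩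
    · refine ⟨z 1, h1, hz 0 (by omega), ?_⟩
      have := G.d_le_path_length (z := fun k => z (k + 1)) rfl hn htail
      simp only [zero_add] at this ⊢
      linarith

/-- A geodesic between distinct points has a first step. -/
theorem exists_geodesic_step {x y : V} (hxy : x ≠ y) :
    ∃ w, w ≠ x ∧ 0 < G.P x w ∧ G.d x y = G.d x w + G.d w y := by
  classical
  have hstep : ∀ (n : ℕ) (z : ℕ → V), z 0 = x → z n = y →
      (∀ k < n, 0 < G.P (z k) (z (k + 1))) → ∃ w, w ≠ x ∧ 0 < G.P x w ∧
        G.d x w + G.d w y ≤ ∑ k ∈ Finset.range n, G.d (z k) (z (k + 1)) := by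
    rintro n z rfl hn hz
    exact G.exists_step_le_path_length n z hxy hn hz
  obtain ⟨n, z, h0, hn, hz⟩ := G.connected x y
  obtain ⟨w, hw, hP, -⟩ := hstep n z h0 hn hz
  -- The infimum over paths is not known to be attained, but a best first step is, since there are
  -- finitely many neighbours.
  obtain ⟨w, hwZ, hmin⟩ := Finset.exists_min_image
    (Finset.univ.filter fun w => w ≠ x ∧ 0 < G.P x w) (fun w => G.d x w + G.d w y)
    ⟨w, by simp [hw, hP]⟩
  simp only [Finset.mem_filter, Finset.mem_univ, true_and] at hwZ hmin
  refine ⟨w, hwZ.1, hwZ.2, le_antisymm (G.d_triangle x w y) ((G.d_path x y).2 ?_)⟩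
  rintro l ⟨n, z, h0, hn, hz, rfl⟩
  obtain ⟨w', hw', hP', hl⟩ := hstep n z h0 hn hz
  exact (hmin w' ⟨hw', hP'⟩).trans hl

theorem sub_le_of_mem_lip1 {f : V → ℝ} (hf : f ∈ G.lip1) (x y : V) : f y - f x ≤ G.d x y :=
  (le_abs_self _).trans (hf x y)

theorem mem_lip1_of_sub_le {f : V → ℝ} (hf : ∀ x y, f y - f x ≤ G.d x y) : f ∈ G.lip1 := by
  intro x y
  rw [abs_le]
  have := hf y x
  rw [G.d_symm] at this
  exact ⟨by linarith, hf x y⟩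

theorem abs_laplacian_le {f : V → ℝ} (hf : f ∈ G.lip1) (x : V) :
    |G.laplacian f x| ≤ ∑ y, G.P x y * G.d x y := by
  refine (Finset.abs_sum_le_sum_abs _ _).trans (Finset.sum_le_sum fun y _ => ?_)
  rw [abs_mul, abs_of_nonneg (G.P_nonneg x y)]
  exact mul_le_mul_of_nonneg_left (hf x y) (G.P_nonneg x y)

variable {G} in
theorem HasNonnegCurvature.laplacian_le_of_edge (hG : G.HasNonnegCurvature) {f : V → ℝ}
    (hf : f ∈ G.lip1) {x y : V} (hne : x ≠ y) (hP : 0 < G.P x y) (hxy : f y - f x = G.d x y) :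
    G.laplacian f y ≤ G.laplacian f x := by
  have hd := G.d_pos hne
  have h : 0 ≤ (G.laplacian f x - G.laplacian f y) / G.d x y := by
    -- A real `sInf` is a lower bound only for a set bounded below; the uniform bound on Laplacians
    -- of Lipschitz functions supplies this.
    refine (hG x y hne hP).trans (csInf_le ?_ ⟨f, hf, hxy, rfl⟩)
    refine ⟨-((∑ z, G.P x z * G.d x z) + ∑ z, G.P y z * G.d y z) / G.d x y, ?_⟩
    rintro r ⟨g, hg, -, rfl⟩
    have h1 := abs_le.1 (G.abs_laplacian_le hg x)
    have h2 := abs_le.1 (G.abs_laplacian_le hg y)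
    gcongr
    linarith
  have := (div_nonneg_iff.1 h).resolve_right (by rintro ⟨-, h⟩; linarith)
  linarith

variable {G} in
/-- Under non-negative curvature, the Laplacian of a Lipschitz function decreases along any pair of
points realising the Lipschitz constant. -/
theorem HasNonnegCurvature.laplacian_le (hG : G.HasNonnegCurvature) {f : V → ℝ}
    (hf : f ∈ G.lip1) {x y : V} (hxy : f y - f x = G.d x y) :
    G.laplacian f y ≤ G.laplacian f x := by
  -- Induction on the distance to `y`, well founded because `V` is finite. The first step of a
  -- geodesic splits a tight pair into two tight pairs.
  have hwf : WellFounded fun a b : V => G.d a y < G.d b y :=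
    InvImage.wf (fun a => Finset.card {z : V | G.d z y < G.d a y} ) wellFounded_lt |>.mono
      (by
        intro a b hab
        refine Finset.card_lt_card (Finset.ssubset_iff_of_subset ?_ |>.2 ⟨a, ?_, ?_⟩)
        · intro z hz
          simp only [Finset.mem_filter, Finset.mem_univ, true_and] at hz ⊢
          exact hz.trans hab
        · simpa using hab
        · simp)
  induction x using hwf.induction with
  | _ x ih =>
    by_cases hne : x = y
    · rw [hne]
    · obtain ⟨w, hw, hP, hd⟩ := G.exists_geodesic_step hne
      have h1 := G.sub_le_of_mem_lip1 hf x w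
      have h2 := G.sub_le_of_mem_lip1 hf w y
      have h3 := G.d_pos hw.symm
      exact (ih w (by linarith) (by linarith)).trans
        (hG.laplacian_le_of_edge hf hw.symm hP (by linarith))

/-! ### Laplacian separation -/

theorem laplacian_continuous (x : V) : Continuous fun f : V → ℝ => G.laplacian f x := by
  unfold laplacian
  fun_prop

theorem isClosed_lip1 : IsClosed G.lip1 := by
  have : G.lip1 = ⋂ x, ⋂ y, {f : V → ℝ | |f y - f x| ≤ G.d x y} := by
    ext f; simp [lip1]
  rw [this]
  exact isClosed_iInter fun x => isClosed_iInter fun y =>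
    isClosed_le (by fun_prop) continuous_const

/-- The minimal non-positive Lipschitz function with `Δ f ≤ ε f` on `A`. -/
theorem exists_minimal_supersolution {A : Set V} (hA : A.Nonempty) {ε : ℝ} (hε : 0 < ε) :
    ∃ f ∈ G.lip1, (∀ x, f x ≤ 0) ∧ (∀ x ∈ A, G.laplacian f x ≤ ε * f x) ∧
      ∀ g ∈ G.lip1, (∀ x, g x ≤ f x) → (∀ x ∈ A, G.laplacian g x ≤ ε * g x) → g = f := by
  obtain ⟨a, ha⟩ := hA
  let S : Set (V → ℝ) := {f | f ∈ G.lip1 ∧ (∀ x, f x ≤ 0) ∧ ∀ x ∈ A, G.laplacian f x ≤ ε * f x}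
  have hclosed : IsClosed S := by
    have : S = G.lip1 ∩ ((⋂ x, {f | f x ≤ 0}) ∩ ⋂ x ∈ A, {f | G.laplacian f x ≤ ε * f x}) := by
      ext f; simp only [S, Set.mem_inter_iff, Set.mem_iInter, Set.mem_ofPred_eq]
    rw [this]
    refine G.isClosed_lip1.inter (IsClosed.inter ?_ ?_)
    · exact isClosed_iInter fun x => isClosed_le (by fun_prop) continuous_const
    · exact isClosed_iInter fun x => isClosed_iInter fun _ =>
        isClosed_le (G.laplacian_continuous x) (by fun_prop)
  have hcompact : IsCompact S := by
    -- At `a ∈ A`, ε f(a) ≥ Δf(a), which is bounded below; the Lipschitz condition carries the lower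
    -- bound to all points.
    refine (isCompact_Icc (a := fun x => -(∑ y, G.P a y * G.d a y) / ε - G.d x a)
      (b := fun _ : V => (0 : ℝ))).of_isClosed_subset hclosed ?_
    rintro f ⟨hf, hf0, hfA⟩
    refine ⟨fun x => ?_, hf0⟩
    have h1 := G.sub_le_of_mem_lip1 hf x a
    have h2 : -(∑ y, G.P a y * G.d a y) / ε ≤ f a := by
      rw [div_le_iff₀ hε]
      linarith [hfA a ha, (abs_le.1 (G.abs_laplacian_le hf a)).1]
    simp only
    linarith
  have hne : S.Nonempty := ⟨fun _ => 0, fun x y => by simpa using G.d_nonneg x y,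
    fun _ => le_rfl, fun x _ => by simp [laplacian]⟩
  -- A minimiser of the total sum has no other member of `S` pointwise below it.
  obtain ⟨f, hfS, hmin⟩ := hcompact.exists_isMinOn hne
    (f := fun f : V → ℝ => ∑ x, f x) (by fun_prop)
  refine ⟨f, hfS.1, hfS.2.1, hfS.2.2, fun g hg hgf hgA => ?_⟩
  have hgS : g ∈ S := ⟨hg, fun x => (hgf x).trans (hfS.2.1 x), hgA⟩
  have h1 : ∑ x, f x ≤ ∑ x, g x := hmin hgS
  have h2 := (Finset.sum_eq_sum_iff_of_le fun x (_ : x ∈ Finset.univ) => hgf x).1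
    (le_antisymm (Finset.sum_le_sum fun x _ => hgf x) h1)
  exact funext fun x => h2 x (Finset.mem_univ x)

/-- Otherwise let `U` be the set of points tied to no equality point of `A`. Lowering `f` by a small
η on `U` keeps it admissible: no pair from `U` to its complement is tight, the inequality is strict
on `U ∩ A`, and off `U` the Laplacian can only drop. This contradicts minimality. -/
theorem exists_supersolution_tight {A : Set V} (hA : A.Nonempty) {ε : ℝ} (hε : 0 < ε) :
    ∃ f ∈ G.lip1, (∀ x, f x ≤ 0) ∧ (∀ x ∈ A, G.laplacian f x ≤ ε * f x) ∧
      ∀ x, ∃ y ∈ A, G.laplacian f y = ε * f y ∧ f y - f x = G.d x y := by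
  classical
  obtain ⟨f, hf, hf0, hfA, hmin⟩ := G.exists_minimal_supersolution hA hε
  refine ⟨f, hf, hf0, hfA, ?_⟩
  by_contra! hcon
  obtain ⟨x₀, hx₀⟩ := hcon
  let U : Set V := {x | ∀ y ∈ A, G.laplacian f y = ε * f y → f y - f x ≠ G.d x y}
  have hx₀U : x₀ ∈ U := hx₀
  have hUtight : ∀ x ∈ U, ∀ y ∉ U, f y - f x < G.d x y := by
    intro x hx y hy
    refine lt_of_le_of_ne (G.sub_le_of_mem_lip1 hf x y) fun h => ?_
    simp only [U, Set.mem_ofPred_eq, not_forall, not_not] at hy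
    obtain ⟨z, hzA, hz, hzy⟩ := hy
    refine hx z hzA hz (le_antisymm (G.sub_le_of_mem_lip1 hf x z) ?_)
    linarith [G.d_triangle x y z]
  have hUstrict : ∀ x ∈ U, x ∈ A → G.laplacian f x < ε * f x := fun x hx hxA =>
    lt_of_le_of_ne (hfA x hxA) fun h => hx x hxA h (by simp [d_self])
  have hsmall : ∀ K gap : ℝ, 0 < gap → ∀ᶠ η in 𝓝[>] (0 : ℝ), η * K ≤ gap := by
    intro K gap hgap
    have : Tendsto (fun η : ℝ => η * K) (𝓝[>] 0) (𝓝 0) := by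
      have h : Continuous fun η : ℝ => η * K := by fun_prop
      simpa using (h.tendsto 0).mono_left nhdsWithin_le_nhds
    exact (this.eventually (gt_mem_nhds hgap)).mono fun _ h => h.le
  have hev1 : ∀ᶠ η in 𝓝[>] (0 : ℝ), ∀ x y : V, x ∈ U → y ∉ U → η ≤ G.d x y - (f y - f x) := by
    refine eventually_all.2 fun x => eventually_all.2 fun y => ?_
    by_cases h : x ∈ U ∧ y ∉ U
    · filter_upwards [hsmall 1 _ (sub_pos.2 (hUtight x h.1 y h.2))] with η hη _ _
      linarith
    · exact Eventually.of_forall fun η h1 h2 => absurd ⟨h1, h2⟩ h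
  have hev2 : ∀ᶠ η in 𝓝[>] (0 : ℝ), ∀ x : V, x ∈ U → x ∈ A →
      η * (∑ y, G.P x y + ε) ≤ ε * f x - G.laplacian f x := by
    refine eventually_all.2 fun x => ?_
    by_cases h : x ∈ U ∧ x ∈ A
    · filter_upwards [hsmall (∑ y, G.P x y + ε) _ (sub_pos.2 (hUstrict x h.1 h.2))] with η hη _ _
      exact hη
    · exact Eventually.of_forall fun η h1 h2 => absurd ⟨h1, h2⟩ h
  obtain ⟨η, hη1, hη2, hη0⟩ := (hev1.and (hev2.and self_mem_nhdsWithin)).exists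
  have hη0 : 0 < η := hη0
  let g : V → ℝ := fun x => f x - if x ∈ U then η else 0
  have hgU : ∀ x ∈ U, g x = f x - η := fun x hx => by simp [g, hx]
  have hgU' : ∀ x ∉ U, g x = f x := fun x hx => by simp [g, hx]
  have hgle : ∀ x, g x ≤ f x := fun x => by
    by_cases hx : x ∈ U
    · rw [hgU x hx]; linarith
    · rw [hgU' x hx]
  have hglip : g ∈ G.lip1 := by
    refine G.mem_lip1_of_sub_le fun x y => ?_
    have h1 := G.sub_le_of_mem_lip1 hf x y
    by_cases hx : x ∈ U
    · by_cases hy : y ∈ U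
      · rw [hgU x hx, hgU y hy]; linarith
      · rw [hgU x hx, hgU' y hy]; linarith [hη1 x y hx hy]
    · rw [hgU' x hx]; linarith [hgle y]
  have hgA : ∀ x ∈ A, G.laplacian g x ≤ ε * g x := by
    intro x hxA
    by_cases hx : x ∈ U
    · have h1 : G.laplacian g x ≤ G.laplacian f x + η * ∑ y, G.P x y := by
        unfold laplacian
        rw [Finset.mul_sum, ← Finset.sum_add_distrib]
        refine Finset.sum_le_sum fun y _ => ?_
        rw [hgU x hx]
        nlinarith [G.P_nonneg x y, hgle y]
      have := hη2 x hx hxA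
      rw [hgU x hx]
      linarith
    · rw [hgU' x hx]
      refine le_trans (Finset.sum_le_sum fun y _ => ?_) (hfA x hxA)
      rw [hgU' x hx]
      exact mul_le_mul_of_nonneg_left (by linarith [hgle y]) (G.P_nonneg x y)
  have hgf := congrFun (hmin g hglip hgle hgA) x₀
  rw [hgU x₀ hx₀U] at hgf
  linarith

variable {G} in
/-- Laplacian separation: a Lipschitz function with `Δ f ≥ ε f`, with equality on `A`, which solves
the eikonal equation outside of `A`. -/
theorem HasNonnegCurvature.exists_separating (hG : G.HasNonnegCurvature) {A : Set V}
    (hA : A.Nonempty) {ε : ℝ} (hε : 0 < ε) :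
    ∃ f ∈ G.lip1, (∀ x, f x ≤ 0) ∧ (∀ x ∈ A, G.laplacian f x ≤ ε * f x) ∧
      (∀ x, ε * f x ≤ G.laplacian f x) ∧
      ∀ x ∉ A, ∃ y, x ≠ y ∧ 0 < G.P x y ∧ f y - f x = G.d x y := by
  obtain ⟨f, hf, hf0, hfA, htight⟩ := G.exists_supersolution_tight hA hε
  refine ⟨f, hf, hf0, hfA, fun x => ?_, fun x hx => ?_⟩
  · obtain ⟨y, -, hy, hxy⟩ := htight x
    have h1 := hG.laplacian_le hf hxy
    have h2 := G.d_nonneg x y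
    nlinarith
  · obtain ⟨y, hyA, -, hxy⟩ := htight x
    obtain ⟨w, hw, hP, hd⟩ := G.exists_geodesic_step (x := x) (y := y)
      (by rintro rfl; exact hx hyA)
    refine ⟨w, hw.symm, hP, ?_⟩
    linarith [G.sub_le_of_mem_lip1 hf x w, G.sub_le_of_mem_lip1 hf w y]

end

/-! ### Dirichlet forms and the eigenvalue dichotomy -/

section

variable {V : Type*} [Fintype V] (G : MetricMarkovChain V) {m : V → ℝ}

section DirichletForm

variable {G}

/-- Green's formula. -/
theorem IsReversible.dirichletForm_eq (hrev : G.IsReversible m) (f g : V → ℝ) :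
    G.dirichletForm m f g =
      (1 / 2) * ∑ x, ∑ y, m x * G.P x y * ((f x - f y) * (g x - g y)) := by
  have h1 : G.dirichletForm m f g = ∑ x, ∑ y, m x * G.P x y * ((f x - f y) * g x) := by
    unfold dirichletForm inner laplacian
    rw [← Finset.sum_neg_distrib]
    refine Finset.sum_congr rfl fun x _ => ?_
    rw [Finset.sum_mul, Finset.sum_mul, ← Finset.sum_neg_distrib]
    exact Finset.sum_congr rfl fun y _ => by ring
  have h2 : G.dirichletForm m f g = -∑ x, ∑ y, m x * G.P x y * ((f x - f y) * g y) := by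
    rw [h1, Finset.sum_comm, ← Finset.sum_neg_distrib]
    refine Finset.sum_congr rfl fun x _ => ?_
    rw [← Finset.sum_neg_distrib]
    refine Finset.sum_congr rfl fun y _ => ?_
    rw [hrev y x]
    ring
  have h3 : ∑ x, ∑ y, m x * G.P x y * ((f x - f y) * (g x - g y)) =
      ∑ x, ∑ y, m x * G.P x y * ((f x - f y) * g x)
        - ∑ x, ∑ y, m x * G.P x y * ((f x - f y) * g y) := by
    simp_rw [← Finset.sum_sub_distrib]
    exact Finset.sum_congr rfl fun x _ => Finset.sum_congr rfl fun y _ => by ring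
  rw [h3]
  linarith

theorem IsReversible.dirichletForm_self_eq (hrev : G.IsReversible m) (f : V → ℝ) :
    G.dirichletForm m f f = (1 / 2) * ∑ x, ∑ y, m x * G.P x y * (f x - f y) ^ 2 := by
  rw [hrev.dirichletForm_eq]
  simp_rw [pow_two]

theorem IsReversible.dirichletForm_mono (hrev : G.IsReversible m) (hm : ∀ x, 0 ≤ m x)
    {f g : V → ℝ} (h : ∀ x y, (f x - f y) ^ 2 ≤ (g x - g y) ^ 2) :
    G.dirichletForm m f f ≤ G.dirichletForm m g g := by
  rw [hrev.dirichletForm_self_eq, hrev.dirichletForm_self_eq]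
  refine mul_le_mul_of_nonneg_left ?_ (by norm_num)
  exact Finset.sum_le_sum fun x _ => Finset.sum_le_sum fun y _ =>
    mul_le_mul_of_nonneg_left (h x y) (mul_nonneg (hm x) (G.P_nonneg x y))

theorem IsReversible.dirichletForm_nonneg (hrev : G.IsReversible m) (hm : ∀ x, 0 ≤ m x)
    (f : V → ℝ) : 0 ≤ G.dirichletForm m f f := by
  rw [hrev.dirichletForm_self_eq]
  exact mul_nonneg (by norm_num) (Finset.sum_nonneg fun x _ => Finset.sum_nonneg fun y _ =>
    mul_nonneg (mul_nonneg (hm x) (G.P_nonneg x y)) (sq_nonneg _))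

/-- Barta's inequality: a positive supersolution bounds the Dirichlet eigenvalue from below. -/
theorem IsReversible.barta (hrev : G.IsReversible m) (hm : ∀ x, 0 ≤ m x) {v w : V → ℝ}
    {l : ℝ} (hw : ∀ x, 0 < w x) (hvw : ∀ x, v x ≠ 0 → l * w x ≤ -G.laplacian w x) :
    l * ∑ x, m x * v x ^ 2 ≤ G.dirichletForm m v v := by
  have h1 : l * ∑ x, m x * v x ^ 2 ≤ G.dirichletForm m w (fun x => v x ^ 2 / w x) := by
    unfold dirichletForm inner
    rw [Finset.mul_sum, ← Finset.sum_neg_distrib]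
    refine Finset.sum_le_sum fun x _ => ?_
    by_cases hx : v x = 0
    · simp [hx]
    · have h2 : 0 ≤ m x * (v x ^ 2 / w x) :=
        mul_nonneg (hm x) (div_nonneg (sq_nonneg _) (hw x).le)
      have h3 := mul_le_mul_of_nonneg_left (hvw x hx) h2
      have h4 : m x * (v x ^ 2 / w x) * (l * w x) = l * (m x * v x ^ 2) := by
        field_simp [(hw x).ne']
      rw [h4] at h3
      linarith
  refine h1.trans ?_
  rw [hrev.dirichletForm_eq, hrev.dirichletForm_self_eq]
  refine mul_le_mul_of_nonneg_left ?_ (by norm_num)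
  refine Finset.sum_le_sum fun x _ => Finset.sum_le_sum fun y _ =>
    mul_le_mul_of_nonneg_left ?_ (mul_nonneg (hm x) (G.P_nonneg x y))
  have hx := hw x
  have hy := hw y
  -- Discrete Picone identity: the defect is a square.
  have h5 : (v x - v y) ^ 2 - (w x - w y) * (v x ^ 2 / w x - v y ^ 2 / w y)
      = (w y * v x - w x * v y) ^ 2 / (w x * w y) := by
    field_simp
    ring
  have h6 : 0 ≤ (w y * v x - w x * v y) ^ 2 / (w x * w y) := by positivity
  linarith

end DirichletForm

theorem exp_sub_one_ge_of_pos {r : ℝ} (hr : 0 ≤ r) : r + r ^ 2 / 2 ≤ Real.exp r - 1 := by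
  linarith [Real.quadratic_le_exp_of_nonneg hr]

/-- Every edge contributes at least the linear part of exp; only the full-slope edge to `y` is
expanded to second order. -/
theorem le_laplacian_exp {f : V → ℝ} {s p : ℝ} (hs : 0 ≤ s) {x y : V} (hxy : G.d x y = f y - f x)
    (hp : p ≤ G.P x y * G.d x y ^ 2) :
    Real.exp (s * f x) * (s * G.laplacian f x + p * s ^ 2 / 2) ≤
      G.laplacian (fun z => Real.exp (s * f z)) x := by
  classical
  have h1 : G.laplacian (fun z => Real.exp (s * f z)) x =
      Real.exp (s * f x) * ∑ z, G.P x z * (Real.exp (s * (f z - f x)) - 1) := by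
    unfold laplacian
    rw [Finset.mul_sum]
    refine Finset.sum_congr rfl fun z _ => ?_
    rw [mul_sub s, Real.exp_sub]
    field_simp
  rw [h1]
  refine mul_le_mul_of_nonneg_left ?_ (Real.exp_pos _).le
  have h2 : s * G.laplacian f x + p * s ^ 2 / 2 ≤
      ∑ z, (G.P x z * (s * (f z - f x)) + if z = y then p * s ^ 2 / 2 else 0) := by
    rw [Finset.sum_add_distrib, Finset.sum_ite_eq' Finset.univ y]
    simp only [Finset.mem_univ, if_true]
    unfold laplacian
    rw [Finset.mul_sum]
    refine add_le_add (Finset.sum_le_sum fun z _ => le_of_eq (by ring)) le_rfl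
  refine h2.trans (Finset.sum_le_sum fun z _ => ?_)
  by_cases hz : z = y
  · subst hz
    have h3 := exp_sub_one_ge_of_pos (r := s * (f z - f x))
      (mul_nonneg hs (hxy ▸ G.d_nonneg x z))
    have h4 := mul_le_mul_of_nonneg_left h3 (G.P_nonneg x z)
    have h5 := mul_le_mul_of_nonneg_right hp (sq_nonneg s)
    rw [hxy] at h5
    simp only [if_true]
    nlinarith
  · simp only [hz, if_false, add_zero]
    refine mul_le_mul_of_nonneg_left ?_ (G.P_nonneg x z)
    linarith [Real.add_one_le_exp (s * (f z - f x))]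

variable {G} in
/-- For every partition of `V` into two sets, the Dirichlet eigenvalue of one of them is large. -/
theorem HasNonnegCurvature.dirichlet_dichotomy [Nonempty V] (hG : G.HasNonnegCurvature)
    (hrev : G.IsReversible m)
    (hm : ∀ x, 0 ≤ m x) {p D L : ℝ} (hp : 0 < p) (hL : 0 < L) (hD : 0 < D)
    (hpP : ∀ x y, x ≠ y → 0 < G.P x y → p ≤ G.P x y * G.d x y ^ 2) (hdD : ∀ x y, G.d x y ≤ D)
    (A : Set V) :
    (∀ v : V → ℝ, (∀ x ∉ A, v x = 0) →
      p / (32 * D ^ 2) * L * ∑ x, m x * v x ^ 2 ≤ G.dirichletForm m v v) ∨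
    (∀ v : V → ℝ, (∀ x ∈ A, v x = 0) →
      p / (32 * D ^ 2) * (L ^ 2 * Real.exp (-(L / 2))) * ∑ x, m x * v x ^ 2
        ≤ G.dirichletForm m v v) := by
  rcases A.eq_empty_or_nonempty with rfl | hA
  · left
    intro v hv
    have : ∀ x, v x = 0 := fun x => hv x (by simp)
    simpa [this] using hrev.dirichletForm_nonneg hm v
  -- With ε = c₀ / D, the function εf oscillates by at most c₀. The value of c₀ makes both
  -- alternatives below come out with the factor p / (32 D²).
  set c₀ : ℝ := p * L / (16 * D) with hc₀
  have hc₀pos : 0 < c₀ := by positivity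
  obtain ⟨f, hf, hf0, hfA, hfV, hfup⟩ := hG.exists_separating hA (div_pos hc₀pos hD)
  obtain ⟨x₀, hx₀⟩ := Finite.exists_max f
  have hmin : ∀ x, f x₀ - D ≤ f x := fun x => by
    linarith [G.sub_le_of_mem_lip1 hf x x₀, hdD x x₀]
  set c : ℝ := -(c₀ / D * f x₀) with hc
  have hlapA : ∀ x ∈ A, G.laplacian f x ≤ -c := fun x hx => by
    have := mul_le_mul_of_nonneg_left (hx₀ x) (div_pos hc₀pos hD).le
    linarith [hfA x hx]
  have hlap : ∀ x, -(c + c₀) ≤ G.laplacian f x := fun x => by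
    have h1 := mul_le_mul_of_nonneg_left (hmin x) (div_pos hc₀pos hD).le
    have h2 : c₀ / D * (f x₀ - D) = -(c + c₀) := by rw [hc]; field_simp; ring
    linarith [hfV x]
  rcases le_or_gt c₀ c with hcase | hcase
  · left
    intro v hv
    -- This `w` lies between D and 2D, and -Δw ≥ c₀ on `A`.
    refine hrev.barta hm (w := fun x => f x - f x₀ + 2 * D) (fun x => by linarith [hmin x])
      fun x hx => ?_
    have hxA : x ∈ A := by_contra fun h => hx (hv x h)
    have h1 : G.laplacian (fun x => f x - f x₀ + 2 * D) x = G.laplacian f x :=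
      Finset.sum_congr rfl fun y _ => by ring
    rw [h1]
    have h2 : p / (32 * D ^ 2) * L * (2 * D) = c₀ := by rw [hc₀]; field_simp; ring
    have h3 : p / (32 * D ^ 2) * L * (f x - f x₀ + 2 * D) ≤ p / (32 * D ^ 2) * L * (2 * D) :=
      mul_le_mul_of_nonneg_left (by linarith [hx₀ x]) (by positivity)
    linarith [hlapA x hxA]
  · right
    intro v hv
    set s : ℝ := L / (2 * D) with hs
    have hspos : 0 < s := by positivity
    set g : V → ℝ := fun x => f x - f x₀ with hg
    have hg0 : ∀ x, g x ≤ 0 := fun x => by simp only [hg]; linarith [hx₀ x]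
    have hexp : ∀ x, Real.exp (s * g x) ≤ 1 := fun x =>
      Real.exp_le_one_iff.2 (mul_nonpos_of_nonneg_of_nonpos hspos.le (hg0 x))
    refine hrev.barta hm (w := fun x => 2 - Real.exp (s * g x)) (fun x => by linarith [hexp x])
      fun x hx => ?_
    have hxA : x ∉ A := fun h => hx (hv x h)
    obtain ⟨y, hxy, hP, hd⟩ := hfup x hxA
    have h1 : -G.laplacian (fun x => 2 - Real.exp (s * g x)) x =
        G.laplacian (fun x => Real.exp (s * g x)) x := by
      unfold laplacian
      rw [← Finset.sum_neg_distrib]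
      exact Finset.sum_congr rfl fun y _ => by ring
    have h2 := G.le_laplacian_exp (f := g) hspos.le (x := x) (y := y) (by simp only [hg]; linarith)
      (hpP x y hxy hP)
    have h3 : G.laplacian g x = G.laplacian f x :=
      Finset.sum_congr rfl fun y _ => by simp only [hg]; ring
    -- Here Δf ≥ -2c₀, and the choice s = L / (2D) makes the loss 2c₀s exactly half of the gain p s²
    -- / 2.
    have h4 : p / (32 * D ^ 2) * L ^ 2 * 2 ≤ s * G.laplacian g x + p * s ^ 2 / 2 := by
      have h5 : p / (32 * D ^ 2) * L ^ 2 * 2 = s * (-(2 * c₀)) + p * s ^ 2 / 2 := by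
        rw [hs, hc₀]; field_simp; ring
      rw [h5, h3]
      have := mul_le_mul_of_nonneg_left (hlap x) hspos.le
      nlinarith
    have h6 : Real.exp (-(L / 2)) ≤ Real.exp (s * g x) := by
      refine Real.exp_le_exp.2 ?_
      have h7 : s * (-D) = -(L / 2) := by rw [hs]; field_simp
      rw [← h7]
      exact mul_le_mul_of_nonneg_left (by simp only [hg]; linarith [hmin x]) hspos.le
    rw [h1]
    refine le_trans ?_ h2
    calc p / (32 * D ^ 2) * (L ^ 2 * Real.exp (-(L / 2))) * (2 - Real.exp (s * g x))
        ≤ p / (32 * D ^ 2) * (L ^ 2 * Real.exp (-(L / 2))) * 2 :=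
          mul_le_mul_of_nonneg_left (by linarith [Real.exp_pos (s * g x)]) (by positivity)
      _ = Real.exp (-(L / 2)) * (p / (32 * D ^ 2) * L ^ 2 * 2) := by ring
      _ ≤ Real.exp (s * g x) * (p / (32 * D ^ 2) * L ^ 2 * 2) :=
          mul_le_mul_of_nonneg_right h6 (by positivity)
      _ ≤ _ := mul_le_mul_of_nonneg_left h4 (Real.exp_pos _).le

end

/-! ### Poincaré inequality -/

section

variable {V : Type*} [Fintype V] {G : MetricMarkovChain V} {m : V → ℝ}

/-- The dichotomy does not say which side has the large eigenvalue; at a balanced level, controlling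
either the positive or the negative part suffices. -/
theorem exists_balanced_level [Nonempty V] (hm : ∀ x, 0 ≤ m x) (f : V → ℝ) :
    ∃ t : ℝ, ∑ x, m x * max (f x - t) 0 ^ 2 = ∑ x, m x * max (t - f x) 0 ^ 2 := by
  obtain ⟨a, ha⟩ := Finite.exists_max f
  obtain ⟨b, hb⟩ := Finite.exists_min f
  have hcont : Continuous fun t : ℝ =>
      ∑ x, m x * max (f x - t) 0 ^ 2 - ∑ x, m x * max (t - f x) 0 ^ 2 := by fun_prop
  obtain ⟨t, ht⟩ := mem_range_of_exists_le_of_exists_ge hcont (c := 0)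
    ⟨f a, by
      have h1 : ∑ x, m x * max (f x - f a) 0 ^ 2 = 0 := Finset.sum_eq_zero fun x _ => by
        rw [max_eq_right (by linarith [ha x])]; ring
      have h2 : 0 ≤ ∑ x, m x * max (f a - f x) 0 ^ 2 :=
        Finset.sum_nonneg fun x _ => mul_nonneg (hm x) (sq_nonneg _)
      linarith⟩
    ⟨f b, by
      have h1 : ∑ x, m x * max (f b - f x) 0 ^ 2 = 0 := Finset.sum_eq_zero fun x _ => by
        rw [max_eq_right (by linarith [hb x])]; ring
      have h2 : 0 ≤ ∑ x, m x * max (f x - f b) 0 ^ 2 :=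
        Finset.sum_nonneg fun x _ => mul_nonneg (hm x) (sq_nonneg _)
      linarith⟩
  exact ⟨t, by simpa [sub_eq_zero] using ht⟩

theorem HasNonnegCurvature.poincare [Nonempty V] (hG : G.HasNonnegCurvature)
    (hrev : G.IsReversible m) (hm : ∀ x, 0 ≤ m x) {p D : ℝ} (hp : 0 < p) (hD : 0 < D)
    (hpP : ∀ x y, x ≠ y → 0 < G.P x y → p ≤ G.P x y * G.d x y ^ 2) (hdD : ∀ x y, G.d x y ≤ D)
    (f : V → ℝ) :
    ∃ t : ℝ, p / (32 * D ^ 2) * ∑ x, m x * (f x - t) ^ 2 ≤ 4 * G.dirichletForm m f f := by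
  obtain ⟨t, ht⟩ := exists_balanced_level hm f
  refine ⟨t, ?_⟩
  have hsplit : ∑ x, m x * (f x - t) ^ 2 =
      ∑ x, m x * max (f x - t) 0 ^ 2 + ∑ x, m x * max (t - f x) 0 ^ 2 := by
    rw [← Finset.sum_add_distrib]
    refine Finset.sum_congr rfl fun x _ => ?_
    rcases le_total (f x) t with h | h
    · rw [max_eq_right (sub_nonpos.2 h), max_eq_left (sub_nonneg.2 h)]; ring
    · rw [max_eq_left (sub_nonneg.2 h), max_eq_right (sub_nonpos.2 h)]; ring
  have hpos : G.dirichletForm m (fun x => max (f x - t) 0) (fun x => max (f x - t) 0) ≤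
      G.dirichletForm m f f := hrev.dirichletForm_mono hm fun x y =>
    sq_le_sq.2 ((abs_max_sub_max_le_abs _ _ _).trans_eq (by congr 1; ring))
  have hneg : G.dirichletForm m (fun x => max (t - f x) 0) (fun x => max (t - f x) 0) ≤
      G.dirichletForm m f f := hrev.dirichletForm_mono hm fun x y =>
    sq_le_sq.2 ((abs_max_sub_max_le_abs _ _ _).trans_eq (by rw [abs_sub_comm]; congr 1; ring))
  have hR : 0 < p / (32 * D ^ 2) := by positivity
  rcases hG.dirichlet_dichotomy hrev hm hp one_pos hD hpP hdD {x | t ≤ f x} with h | h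
  · have h1 := (h (fun x => max (f x - t) 0) fun x hx => max_eq_right (by
      simp only [Set.mem_ofPred_eq, not_le] at hx; linarith)).trans hpos
    have h2 := hrev.dirichletForm_nonneg hm f
    rw [hsplit, ← ht]
    linarith
  · have h1 := (h (fun x => max (t - f x) 0) fun x hx => max_eq_right (by
      simp only [Set.mem_ofPred_eq] at hx; linarith)).trans hneg
    have h2 : 0 ≤ ∑ x, m x * max (t - f x) 0 ^ 2 :=
      Finset.sum_nonneg fun x _ => mul_nonneg (hm x) (sq_nonneg _)
    have h3 : (1 : ℝ) / 2 ≤ 1 ^ 2 * Real.exp (-(1 / 2)) := by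
      linarith [Real.add_one_le_exp (-(1 / 2) : ℝ)]
    have h4 := mul_le_mul_of_nonneg_right (mul_le_mul_of_nonneg_left h3 hR.le) h2
    rw [hsplit, ht]
    linarith

/-- Let a be the mean of `f`. The left side is 2 - 2a, the right side is at least 2(1 - a²), and 0 ≤
a ≤ 1. -/
theorem sum_sub_one_sq_le (hm1 : ∑ x, m x = 1) (hm : ∀ x, 0 ≤ m x) {f : V → ℝ}
    (hf0 : ∀ x, 0 ≤ f x) (hf : ∑ x, m x * f x ^ 2 = 1) (t : ℝ) :
    ∑ x, m x * (f x - 1) ^ 2 ≤ 2 * ∑ x, m x * (f x - t) ^ 2 := by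
  have hexpand : ∀ t : ℝ, ∑ x, m x * (f x - t) ^ 2 = 1 - 2 * t * ∑ x, m x * f x + t ^ 2 := by
    intro t
    have : ∑ x, m x * (f x - t) ^ 2 =
        ∑ x, m x * f x ^ 2 - 2 * t * ∑ x, m x * f x + t ^ 2 * ∑ x, m x := by
      rw [Finset.mul_sum, Finset.mul_sum, ← Finset.sum_sub_distrib, ← Finset.sum_add_distrib]
      exact Finset.sum_congr rfl fun x _ => by ring
    rw [this, hf, hm1, mul_one]
  have h0 : 0 ≤ ∑ x, m x * f x := Finset.sum_nonneg fun x _ => mul_nonneg (hm x) (hf0 x)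
  have h1 : 0 ≤ ∑ x, m x * (f x - 1) ^ 2 :=
    Finset.sum_nonneg fun x _ => mul_nonneg (hm x) (sq_nonneg _)
  rw [hexpand 1] at h1 ⊢
  rw [hexpand t]
  nlinarith [sq_nonneg (t - ∑ x, m x * f x)]

/-! ### Dyadic slices -/

/-- The part of `f` between the levels `2 ^ k` and `2 ^ (k + 1)`. -/
def slice {W : Type*} (f : W → ℝ) (k : ℕ) (x : W) : ℝ := min (f x) (2 ^ (k + 1)) - min (f x) (2 ^ k)

/-- Truncation and slicing are monotone, so both increments have the same sign and the cross term is
non-negative. -/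
theorem sq_add_sq_min_sub_min_le (a b : ℝ) {u v : ℝ} (huv : u ≤ v) :
    (min a u - min b u) ^ 2 + ((min a v - min a u) - (min b v - min b u)) ^ 2 ≤
      (min a v - min b v) ^ 2 := by
  have h : 0 ≤ (min a u - min b u) * ((min a v - min a u) - (min b v - min b u)) := by
    rcases le_total a b with hab | hab
    · refine mul_nonneg_of_nonpos_of_nonpos ?_ ?_ <;> grind
    · refine mul_nonneg ?_ ?_ <;> grind
  nlinarith

theorem sum_sq_slice_sub_le {W : Type*} (f : W → ℝ) (i N : ℕ) (x y : W) :
    ∑ j ∈ Finset.range N, (slice f (j + i) x - slice f (j + i) y) ^ 2 ≤ (f x - f y) ^ 2 := by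
  have h : ∑ j ∈ Finset.range N, (slice f (j + i) x - slice f (j + i) y) ^ 2 ≤
      (min (f x) (2 ^ (N + i)) - min (f y) (2 ^ (N + i))) ^ 2 := by
    induction N with
    | zero => simpa using sq_nonneg _
    | succ N ih =>
      rw [Finset.sum_range_succ]
      have := sq_add_sq_min_sub_min_le (f x) (f y)
        (pow_le_pow_right₀ (one_le_two (α := ℝ)) (Nat.le_succ (N + i)))
      unfold slice at ih ⊢
      rw [show N + 1 + i = (N + i).succ by omega]
      linarith!
  exact h.trans (sq_le_sq.2 (by
    simpa using abs_min_sub_min_le_max (f x) (2 ^ (N + i)) (f y) (2 ^ (N + i))))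

theorem IsReversible.sum_dirichletForm_slice_le (hrev : G.IsReversible m) (hm : ∀ x, 0 ≤ m x)
    (f : V → ℝ) (i N : ℕ) :
    ∑ j ∈ Finset.range N, G.dirichletForm m (slice f (j + i)) (slice f (j + i)) ≤
      G.dirichletForm m f f := by
  simp_rw [hrev.dirichletForm_self_eq]
  rw [← Finset.mul_sum, Finset.sum_comm]
  refine mul_le_mul_of_nonneg_left (Finset.sum_le_sum fun x _ => ?_) (by norm_num)
  rw [Finset.sum_comm]
  refine Finset.sum_le_sum fun y _ => ?_
  rw [← Finset.mul_sum]
  exact mul_le_mul_of_nonneg_left (sum_sq_slice_sub_le f i N x y)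
    (mul_nonneg (hm x) (G.P_nonneg x y))

open Classical in
-- Apply the dichotomy with L = j + 2 to the set where f ≥ 2^(j+2). If that set has the large
-- eigenvalue, test with slice j + 2, which is full where f ≥ 2^(j+3). Otherwise test its complement
-- with 2^(j+1) minus slice j + 1: this is full where f ≤ 2, so its squared norm is of order
-- 4^(j+1), which beats exp(-L/2), while Chebyshev bounds the left sum by (j+2)/4.
theorem HasNonnegCurvature.level_le_dirichletForm_slice [Nonempty V] (hG : G.HasNonnegCurvature)
    (hrev : G.IsReversible m) (hm1 : ∑ x, m x = 1) (hm : ∀ x, 0 ≤ m x) {p D : ℝ} (hp : 0 < p)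
    (hD : 0 < D) (hpP : ∀ x y, x ≠ y → 0 < G.P x y → p ≤ G.P x y * G.d x y ^ 2)
    (hdD : ∀ x y, G.d x y ≤ D) {f : V → ℝ}
    (hf : ∑ x, m x * f x ^ 2 = 1) (j : ℕ) :
    p / (32 * D ^ 2) * ∑ x, m x * (if 2 ^ (j + 3) ≤ f x then ((j : ℝ) + 2) * 4 ^ (j + 2) else 0) ≤
      G.dirichletForm m (slice f (j + 2)) (slice f (j + 2)) +
        G.dirichletForm m (slice f (j + 1)) (slice f (j + 1)) := by
  have hR : 0 < p / (32 * D ^ 2) := by positivity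
  have h4 : ∀ n : ℕ, (4 : ℝ) ^ n = (2 ^ n) ^ 2 := fun n => by
    rw [← pow_mul, mul_comm, pow_mul]; norm_num
  have hj : (0 : ℝ) < (j : ℝ) + 2 := by positivity
  rcases hG.dirichlet_dichotomy hrev hm hp hj hD hpP hdD {x | 2 ^ (j + 2) ≤ f x} with h | h
  · have h1 := h (slice f (j + 2)) fun x hx => by
      simp only [Set.mem_ofPred_eq, not_le] at hx
      unfold slice
      rw [min_eq_left hx.le, min_eq_left, sub_self]
      exact hx.le.trans (pow_le_pow_right₀ one_le_two (Nat.le_succ _))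
    have h2 := hrev.dirichletForm_nonneg hm (slice f (j + 1))
    refine le_trans ?_ (le_add_of_le_of_nonneg h1 h2)
    rw [mul_assoc, Finset.mul_sum (a := (j : ℝ) + 2)]
    refine mul_le_mul_of_nonneg_left (Finset.sum_le_sum fun x _ => ?_) hR.le
    split_ifs with hx
    · have : slice f (j + 2) x = 2 ^ (j + 2) := by
        unfold slice
        rw [min_eq_right hx, min_eq_right ((pow_le_pow_right₀ one_le_two (Nat.le_succ _)).trans hx)]
        ring
      rw [this, h4]
      exact le_of_eq (by ring)
    · rw [mul_zero]
      exact mul_nonneg hj.le (mul_nonneg (hm x) (sq_nonneg _))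
  · have h1 := h (fun x => 2 ^ (j + 1) - slice f (j + 1) x) fun x hx => by
      simp only [Set.mem_ofPred_eq] at hx
      unfold slice
      rw [min_eq_right hx, min_eq_right ((pow_le_pow_right₀ one_le_two (Nat.le_succ _)).trans hx)]
      ring
    have h2 : G.dirichletForm m (fun x => 2 ^ (j + 1) - slice f (j + 1) x)
        (fun x => 2 ^ (j + 1) - slice f (j + 1) x) ≤
        G.dirichletForm m (slice f (j + 1)) (slice f (j + 1)) :=
      hrev.dirichletForm_mono hm fun x y => le_of_eq (by ring)
    have h3 := hrev.dirichletForm_nonneg hm (slice f (j + 2))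
    have h5 : (4 : ℝ) ^ (j + 1) * (3 / 4) ≤ ∑ x, m x * (2 ^ (j + 1) - slice f (j + 1) x) ^ 2 := by
      have : (4 : ℝ) ^ (j + 1) * (3 / 4) = ∑ x, m x * (4 ^ (j + 1) * (1 - f x ^ 2 / 4)) := by
        have h6 : ∑ x, m x * (4 ^ (j + 1) * (1 - f x ^ 2 / 4)) =
            4 ^ (j + 1) * (∑ x, m x - (∑ x, m x * f x ^ 2) / 4) := by
          rw [Finset.sum_div, ← Finset.sum_sub_distrib, Finset.mul_sum]
          exact Finset.sum_congr rfl fun x _ => by ring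
        rw [h6, hm1, hf]
        norm_num
      rw [this]
      refine Finset.sum_le_sum fun x _ => mul_le_mul_of_nonneg_left ?_ (hm x)
      rcases le_total (f x) 2 with hx | hx
      · have h7 : f x ≤ 2 ^ (j + 1) := hx.trans (le_self_pow₀ one_le_two (by omega))
        have h8 : slice f (j + 1) x = 0 := by
          unfold slice
          rw [min_eq_left h7, min_eq_left, sub_self]
          exact h7.trans (pow_le_pow_right₀ one_le_two (Nat.le_succ _))
        rw [h8, sub_zero, ← h4]
        exact mul_le_of_le_one_right (by positivity) (by linarith [sq_nonneg (f x)])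
      · exact (mul_nonpos_of_nonneg_of_nonpos (by positivity) (by nlinarith)).trans (sq_nonneg _)
    have h9 : ∑ x, m x * (if 2 ^ (j + 3) ≤ f x then ((j : ℝ) + 2) * 4 ^ (j + 2) else 0) ≤
        ((j : ℝ) + 2) / 4 := by
      have h10 : ((j : ℝ) + 2) / 4 = ∑ x, m x * (f x ^ 2 * (((j : ℝ) + 2) / 4)) := by
        simp_rw [← mul_assoc]
        rw [← Finset.sum_mul, hf, one_mul]
      rw [h10]
      refine Finset.sum_le_sum fun x _ => mul_le_mul_of_nonneg_left ?_ (hm x)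
      split_ifs with hx
      · have h11 : (4 : ℝ) ^ (j + 3) ≤ f x ^ 2 := by
          rw [h4]
          exact pow_le_pow_left₀ (by positivity) hx 2
        have h12 := mul_le_mul_of_nonneg_right h11 (show 0 ≤ ((j : ℝ) + 2) / 4 by positivity)
        refine le_trans (le_of_eq ?_) h12
        ring
      · positivity
    have h13 : 1 ≤ Real.exp (-(((j : ℝ) + 2) / 2)) * 4 ^ (j + 1) := by
      rw [Real.exp_neg, ← div_eq_inv_mul, le_div_iff₀ (Real.exp_pos _), one_mul]
      calc Real.exp (((j : ℝ) + 2) / 2) ≤ Real.exp ((j + 1 : ℕ) * 1) :=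
            Real.exp_le_exp.2 (by push_cast; linarith)
        _ = Real.exp 1 ^ (j + 1) := Real.exp_nat_mul 1 (j + 1)
        _ ≤ 4 ^ (j + 1) := pow_le_pow_left₀ (Real.exp_pos _).le
            (by linarith [Real.exp_one_lt_d9]) _
    have h14 : ((j : ℝ) + 2) / 4 ≤ ((j : ℝ) + 2) ^ 2 * Real.exp (-(((j : ℝ) + 2) / 2)) *
        (4 ^ (j + 1) * (3 / 4)) := by
      have : ((j : ℝ) + 2) ^ 2 * (3 / 4) * 1 ≤ ((j : ℝ) + 2) ^ 2 * (3 / 4) *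
          (Real.exp (-(((j : ℝ) + 2) / 2)) * 4 ^ (j + 1)) :=
        mul_le_mul_of_nonneg_left h13 (by positivity)
      nlinarith
    have h15 := mul_le_mul_of_nonneg_left (h9.trans (h14.trans
      (mul_le_mul_of_nonneg_left h5 (by positivity)))) hR.le
    rw [← mul_assoc] at h15
    linarith

/-! ### Entropy and the log-Sobolev inequality -/

open Classical in
-- For a ≤ 8, log a² ≤ a² - 1 bounds the left side by (a² - 1)² ≤ 81(a - 1)². For a > 8, the single
-- term with 2^(j+3) ≤ a < 2^(j+4) suffices.
theorem mul_log_sub_add_one_le {a : ℝ} (ha : 0 ≤ a) {N : ℕ} (haN : a ≤ 2 ^ (N + 3)) :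
    a ^ 2 * Real.log (a ^ 2) - a ^ 2 + 1 ≤ 81 * (a - 1) ^ 2 + 64 * ∑ j ∈ Finset.range (N + 1),
      if 2 ^ (j + 3) ≤ a then ((j : ℝ) + 2) * 4 ^ (j + 2) else 0 := by
  have hterm : ∀ j : ℕ, 0 ≤ if 2 ^ (j + 3) ≤ a then ((j : ℝ) + 2) * 4 ^ (j + 2) else 0 := by
    intro j
    split_ifs <;> positivity
  rcases le_or_gt a 8 with h8 | h8
  · have h1 : a ^ 2 * Real.log (a ^ 2) ≤ a ^ 2 * (a ^ 2 - 1) := by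
      rcases ha.eq_or_lt with rfl | hpos
      · simp
      · exact mul_le_mul_of_nonneg_left (Real.log_le_sub_one_of_pos (by positivity)) (by positivity)
    have h2 : (a + 1) ^ 2 ≤ 81 := by nlinarith
    have h3 := mul_le_mul_of_nonneg_right h2 (sq_nonneg (a - 1))
    have h4 := Finset.sum_nonneg fun j (_ : j ∈ Finset.range (N + 1)) => hterm j
    nlinarith
  · obtain ⟨n, hn, hn'⟩ := exists_nat_pow_near (by linarith : 1 ≤ a) (one_lt_two (α := ℝ))
    have hn3 : 3 ≤ n := by
      by_contra! h
      have : (2 : ℝ) ^ (n + 1) ≤ 2 ^ 3 := pow_le_pow_right₀ one_le_two (by omega)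
      linarith
    obtain ⟨j, rfl⟩ := Nat.exists_eq_add_of_le' hn3
    have hjN : j ≤ N := by
      by_contra! h
      have h1 : (2 : ℝ) ^ (N + 3) < 2 ^ (j + 3) := pow_lt_pow_right₀ one_lt_two (by omega)
      linarith
    have h1 : ((j : ℝ) + 2) * 4 ^ (j + 2) ≤ ∑ j ∈ Finset.range (N + 1),
        if 2 ^ (j + 3) ≤ a then ((j : ℝ) + 2) * 4 ^ (j + 2) else 0 := by
      have := Finset.single_le_sum (fun j _ => hterm j) (Finset.mem_range.2 (Nat.lt_succ_of_le hjN))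
      simpa only [hn, if_true] using this
    have h2 : Real.log (a ^ 2) ≤ 2 * ((j : ℝ) + 4) := by
      rw [Real.log_pow]
      have h3 : Real.log a ≤ (j + 3 + 1 : ℕ) * Real.log 2 := by
        rw [← Real.log_pow]
        exact Real.log_le_log (by linarith) hn'.le
      have h4 : Real.log 2 ≤ 1 := by linarith [Real.log_two_lt_d9]
      have h5 := mul_le_mul_of_nonneg_left h4 (Nat.cast_nonneg (α := ℝ) (j + 3 + 1))
      push_cast at *
      linarith
    have h3 : a ^ 2 ≤ 16 * 4 ^ (j + 2) := by
      have := pow_le_pow_left₀ ha hn'.le 2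
      have h4 : ((2 : ℝ) ^ (j + 3 + 1)) ^ 2 = 16 * 4 ^ (j + 2) := by
        rw [← pow_mul, mul_comm, pow_mul]; norm_num; ring
      linarith
    have h4 : a ^ 2 * Real.log (a ^ 2) ≤ 16 * 4 ^ (j + 2) * (2 * ((j : ℝ) + 4)) :=
      (mul_le_mul_of_nonneg_left h2 (sq_nonneg a)).trans
        (mul_le_mul_of_nonneg_right h3 (by positivity))
    have h5 : 16 * (4 : ℝ) ^ (j + 2) * (2 * ((j : ℝ) + 4)) ≤
        64 * (((j : ℝ) + 2) * 4 ^ (j + 2)) := by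
      have : (0 : ℝ) ≤ 4 ^ (j + 2) * j := by positivity
      linarith
    nlinarith

/-- The added terms cancel by normalisation and make each summand non-negative, vanishing to second
order at f = 1. -/
theorem entropy_sq_eq (hm1 : ∑ x, m x = 1) {f : V → ℝ} (hf : ∑ x, m x * f x ^ 2 = 1) :
    entropy m (fun x => f x ^ 2) =
      ∑ x, m x * (f x ^ 2 * Real.log (f x ^ 2) - f x ^ 2 + 1) := by
  have h : ∑ x, m x * (f x ^ 2 * Real.log (f x ^ 2) - f x ^ 2 + 1) =
      entropy m (fun x => f x ^ 2) - ∑ x, m x * f x ^ 2 + ∑ x, m x := by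
    unfold entropy inner
    rw [← Finset.sum_sub_distrib, ← Finset.sum_add_distrib]
    exact Finset.sum_congr rfl fun x _ => by ring
  rw [h, hf, hm1]
  ring

theorem entropy_sq_nonneg (hm1 : ∑ x, m x = 1) (hm : ∀ x, 0 ≤ m x) {f : V → ℝ}
    (hf : ∑ x, m x * f x ^ 2 = 1) : 0 ≤ entropy m (fun x => f x ^ 2) := by
  rw [entropy_sq_eq hm1 hf]
  refine Finset.sum_nonneg fun x _ => mul_nonneg (hm x) ?_
  rcases (sq_nonneg (f x)).eq_or_lt with h | h
  · rw [← h]; norm_num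
  · have h1 := mul_le_mul_of_nonneg_left (Real.one_sub_inv_le_log_of_pos h) h.le
    have h2 : f x ^ 2 * (1 - (f x ^ 2)⁻¹) = f x ^ 2 - 1 := by
      rw [mul_sub, mul_inv_cancel₀ h.ne', mul_one]
    linarith

theorem HasNonnegCurvature.logSobolev_of_nonneg [Nonempty V] (hG : G.HasNonnegCurvature)
    (hrev : G.IsReversible m) (hm1 : ∑ x, m x = 1) (hm : ∀ x, 0 ≤ m x) {p D : ℝ} (hp : 0 < p)
    (hD : 0 < D) (hpP : ∀ x y, x ≠ y → 0 < G.P x y → p ≤ G.P x y * G.d x y ^ 2)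
    (hdD : ∀ x y, G.d x y ≤ D) {f : V → ℝ} (hf0 : ∀ x, 0 ≤ f x)
    (hf : ∑ x, m x * f x ^ 2 = 1) :
    p / (32 * D ^ 2) * entropy m (fun x => f x ^ 2) ≤ 776 * G.dirichletForm m f f := by
  classical
  have hR : 0 < p / (32 * D ^ 2) := by positivity
  obtain ⟨x₀, hx₀⟩ := Finite.exists_max f
  obtain ⟨N, hN⟩ := pow_unbounded_of_one_lt (f x₀) (one_lt_two (α := ℝ))
  have hfN : ∀ x, f x ≤ 2 ^ (N + 3) := fun x =>
    (hx₀ x).trans (hN.le.trans (pow_le_pow_right₀ one_le_two (by omega)))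
  have hent : entropy m (fun x => f x ^ 2) ≤ 81 * ∑ x, m x * (f x - 1) ^ 2 +
      64 * ∑ j ∈ Finset.range (N + 1), ∑ x, m x *
        (if 2 ^ (j + 3) ≤ f x then ((j : ℝ) + 2) * 4 ^ (j + 2) else 0) := by
    rw [entropy_sq_eq hm1 hf, Finset.sum_comm, Finset.mul_sum, Finset.mul_sum,
      ← Finset.sum_add_distrib]
    refine Finset.sum_le_sum fun x _ => ?_
    rw [← Finset.mul_sum]
    have := mul_le_mul_of_nonneg_left (mul_log_sub_add_one_le (hf0 x) (hfN x)) (hm x)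
    linarith
  have hvar : p / (32 * D ^ 2) * ∑ x, m x * (f x - 1) ^ 2 ≤ 8 * G.dirichletForm m f f := by
    obtain ⟨t, ht⟩ := hG.poincare hrev hm hp hD hpP hdD f
    have := mul_le_mul_of_nonneg_left (sum_sub_one_sq_le hm1 hm hf0 hf t) hR.le
    linarith
  have htail : p / (32 * D ^ 2) * ∑ j ∈ Finset.range (N + 1), ∑ x, m x *
      (if 2 ^ (j + 3) ≤ f x then ((j : ℝ) + 2) * 4 ^ (j + 2) else 0) ≤
        2 * G.dirichletForm m f f := by
    rw [Finset.mul_sum]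
    refine (Finset.sum_le_sum fun j _ =>
      hG.level_le_dirichletForm_slice hrev hm1 hm hp hD hpP hdD hf j).trans ?_
    rw [Finset.sum_add_distrib]
    linarith [hrev.sum_dirichletForm_slice_le hm f 2 (N + 1),
      hrev.sum_dirichletForm_slice_le hm f 1 (N + 1)]
  -- 776 = 81 · 8 + 64 · 2.
  have := mul_le_mul_of_nonneg_left hent hR.le
  linarith

theorem HasNonnegCurvature.logSobolev_inequality [Nonempty V] (hG : G.HasNonnegCurvature)
    (hrev : G.IsReversible m) (hm1 : ∑ x, m x = 1) (hm : ∀ x, 0 ≤ m x) {p D : ℝ} (hp : 0 < p)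
    (hD : 0 < D) (hpP : ∀ x y, x ≠ y → 0 < G.P x y → p ≤ G.P x y * G.d x y ^ 2)
    (hdD : ∀ x y, G.d x y ≤ D) {f : V → ℝ} (hf : ∑ x, m x * f x ^ 2 = 1) :
    p / (32 * D ^ 2) * entropy m (fun x => f x ^ 2) ≤ 776 * G.dirichletForm m f f := by
  have h1 := hG.logSobolev_of_nonneg hrev hm1 hm hp hD hpP hdD (f := fun x => |f x|)
    (fun x => abs_nonneg _) (by simpa using hf)
  have h2 : G.dirichletForm m (fun x => |f x|) (fun x => |f x|) ≤ G.dirichletForm m f f :=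
    hrev.dirichletForm_mono hm fun x y => sq_le_sq.2 (abs_abs_sub_abs_le _ _)
  simp only [sq_abs] at h1
  linarith

theorem sum_mul_sq_eq_one_of_norm2 {f : V → ℝ} (hf : norm2 m f = 1) :
    ∑ x, m x * f x ^ 2 = 1 := by
  have h : inner m f f = 1 := by
    unfold norm2 at hf
    exact Real.sqrt_eq_one.1 hf
  rw [← h]
  exact Finset.sum_congr rfl fun x _ => by ring

theorem IsReversible.pos (hrev : G.IsReversible m) (hm : G.IsInvariantMeasure m) (x : V) :
    0 < m x := by
  obtain ⟨a, -, ha⟩ := Finset.exists_ne_zero_of_sum_ne_zero (s := Finset.univ) (f := m)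
    (by rw [hm.2.1]; exact one_ne_zero)
  obtain ⟨n, z, h0, hn, hz⟩ := G.connected a x
  have key : ∀ k ≤ n, 0 < m (z k) := by
    intro k
    induction k with
    | zero => intro _; rw [h0]; exact lt_of_le_of_ne (hm.1 a) ha.symm
    | succ k ih =>
      intro hk
      have h1 : 0 < m (z (k + 1)) * G.P (z (k + 1)) (z k) := by
        rw [← hrev]
        exact mul_pos (ih (by omega)) (hz k (by omega))
      exact pos_of_mul_pos_left h1 (G.P_nonneg _ _)
  exact hn ▸ key n le_rfl

/-- Keeps the infimum defining the log-Sobolev constant from running over the empty set, where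
`sInf` would be 0. The normalised indicator of a point `a` has entropy -log m(a) > 0. -/
theorem exists_entropy_ne_zero [Nontrivial V] (hpos : ∀ x, 0 < m x) (hm1 : ∑ x, m x = 1) :
    ∃ f : V → ℝ, norm2 m f = 1 ∧ entropy m (fun x => f x ^ 2) ≠ 0 := by
  classical
  obtain ⟨a, b, hab⟩ := exists_pair_ne V
  have ha := hpos a
  have ha1 : m a < 1 := by
    rw [← hm1, ← Finset.add_sum_erase _ _ (Finset.mem_univ a)]
    have : 0 < ∑ x ∈ Finset.univ.erase a, m x :=
      Finset.sum_pos (fun x _ => hpos x) ⟨b, by simp [hab.symm]⟩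
    linarith
  have hsq : (√(m a))⁻¹ * (√(m a))⁻¹ = (m a)⁻¹ := by
    rw [← mul_inv, Real.mul_self_sqrt ha.le]
  refine ⟨fun x => if x = a then (√(m a))⁻¹ else 0, ?_, ?_⟩
  · unfold norm2 inner
    rw [Finset.sum_eq_single a (by intro x _ hx; simp [hx]) (by simp)]
    simp only [if_true]
    rw [hsq, inv_mul_cancel₀ ha.ne', Real.sqrt_one]
  · unfold entropy inner
    rw [Finset.sum_eq_single a (by intro x _ hx; simp [hx]) (by simp)]
    simp only [if_true]
    rw [pow_two, hsq, Real.log_inv, mul_right_comm, inv_mul_cancel₀ ha.ne', one_mul]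
    exact neg_ne_zero.2 (Real.log_neg ha ha1).ne

end

end MetricMarkovChain

end

theorem mainTheorem5 :
    ∃ C : ℝ, 0 < C ∧
      ∀ (V : Type*) [Fintype V] [Nontrivial V] (G : MetricMarkovChain V) (m : V → ℝ),
        G.IsInvariantMeasure m → G.IsReversible m → G.HasNonnegCurvature →
          C * G.minRate / G.diam ^ 2 ≤ G.logSobolev m := by
  -- 24832 = 32 · 776.
  refine ⟨1 / 24832, by norm_num, ?_⟩
  intro V _ _ G m hm hrev hG
  have hle : ∀ x y, G.d x y ≤ G.diam := fun x y =>
    le_ciSup (f := fun p : V × V => G.d p.1 p.2) (Set.finite_range _).bddAbove (x, y)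
  have hD : 0 < G.diam := by
    obtain ⟨a, b, hab⟩ := exists_pair_ne V
    exact (G.d_pos hab).trans_le (hle a b)
  have hrate : ∀ x y, x ≠ y → 0 < G.P x y → G.minRate ≤ G.P x y * G.d x y ^ 2 := by
    intro x y hxy hP
    refine csInf_le ⟨0, ?_⟩ ⟨x, y, hxy, hP, rfl⟩
    rintro r ⟨x, y, -, -, rfl⟩
    exact mul_nonneg (G.P_nonneg x y) (sq_nonneg _)
  obtain ⟨f₀, hf₀, hent₀⟩ := MetricMarkovChain.exists_entropy_ne_zero (hrev.pos hm) hm.2.1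
  refine le_csInf ⟨_, f₀, hf₀, hent₀, rfl⟩ ?_
  rintro r ⟨f, hf, hent, rfl⟩
  have hf1 := MetricMarkovChain.sum_mul_sq_eq_one_of_norm2 hf
  have hpos : 0 < MetricMarkovChain.entropy m (fun x => f x ^ 2) :=
    lt_of_le_of_ne (MetricMarkovChain.entropy_sq_nonneg hm.2.1 hm.1 hf1) hent.symm
  -- The bound is trivial for a non-positive rate, so positivity of the infimum over edges need not
  -- be established.
  rcases le_or_gt G.minRate 0 with h | h
  · refine le_trans ?_ (div_nonneg (hrev.dirichletForm_nonneg hm.1 f) hpos.le)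
    exact div_nonpos_of_nonpos_of_nonneg (by linarith) (sq_nonneg _)
  · rw [le_div_iff₀ hpos]
    have h1 := hG.logSobolev_inequality hrev hm.2.1 hm.1 h hD hrate hle hf1
    have h2 : G.minRate / (32 * G.diam ^ 2) = 776 * (1 / 24832 * G.minRate / G.diam ^ 2) := by
      field_simp
      norm_num
    rw [h2] at h1
    linarith
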